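/- Let $p$ be a prime number, let $R$ be a commutative ring with a ring endomorphism $F$ lifting the Frobenius of $R/p$ (that is, $F(r)\equiv r^p \bmod pR$ for all $r\in R$), and let $q\in R$. For $n\in\mathbb N$ put $(n)_q=1+q+\dots+q^{n-1}\in R$. Assume that $(p)_q=0$ and that $R$ is $q$-divisible, i.e. for every $m\in\mathbb N$ the element $(m)_q$ is either zero or invertible in $R$. Let $A$ be a commutative $R$-algebra with an étale morphism of $R$-algebras $f:R[t]\to A$, and put $x=f(t)$. Let $\sigma:A\to A$ be a morphism of $R$-algebras with $\sigma(x)=qx$. Let $A'=R\otimes_{F,R}A$, an $R$-algebra through the left factor, and let $F^*:A'\to A$ be a morphism of $R$-algebras with $F^*(1\otimes x)=x^p$. Assume, as is automatic for $A=R[t]$, that $F^*$ makes $A$ a finite locally free $A'$-module of rank $p$ and that $\sigma\circ F^*=F^*$. Then there is a unique $R$-linear map $\partial_\sigma:A\to A$ such that $\partial_\sigma(x)=1$ and $\partial_\sigma(z_1z_2)=\partial_\sigma(z_1)z_2+\sigma(z_1)\partial_\sigma(z_2)$ for all $z_1,z_2\in A$. Let $q\text{-}\mathrm{DR}(A/R)$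 be the $q$-de Rham complex of $A$, i.e. the complex of $R$-modules $$0\to A\xrightarrow{\ \nabla\ }A\otimes_A\Omega^1_{A/R}\to 0,\qquad \nabla(a)=\partial_\sigma(a)\otimes dx,$$ with $A$ in degree $0$. Then for every $i\ge 0$ there is an isomorphism of $R$-modules (a "$q$-deformed Cartier isomorphism") $$C_q:\ \mathrm H^i\bigl(q\text{-}\mathrm{DR}(A/R)\bigr)\ \xrightarrow{\ \sim\ }\ \Omega^i_{A'/R}=\textstyle\bigwedge^i_{A'}\Omega^1_{A'/R}.$$ -/

import Mathlib

open CategoryTheory TensorProduct Polynomial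

universe u v

noncomputable section

/-- The `q`-analogue `(n)_q = 1 + q + ⋯ + q ^ (n - 1)` of the natural number `n`, that is, the value
at `u = q` of the polynomial `(u ^ n - 1) / (u - 1)`. -/
def qNumber {R : Type u} [CommRing R] (q : R) (n : ℕ) : R :=
  ∑ i ∈ Finset.range n, q ^ i

/-- `R` is `q`-divisible: each `(m)_q` is zero or invertible. -/
def IsQDivisible {R : Type u} [CommRing R] (q : R) : Prop :=
  ∀ m : ℕ, qNumber q m ≠ 0 → IsUnit (qNumber q m)

/-- The ring `R`, regarded as an `R`-algebra through the ring endomorphism `F`. -/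
def ViaEndo {R : Type u} [CommRing R] (_F : R →+* R) : Type u := R

instance ViaEndo.instCommRing {R : Type u} [CommRing R] (F : R →+* R) : CommRing (ViaEndo F) :=
  inferInstanceAs (CommRing R)

instance ViaEndo.instAlgebra {R : Type u} [CommRing R] (F : R →+* R) : Algebra R (ViaEndo F) :=
  RingHom.toAlgebra (S := ViaEndo F) F

/-- The underlying ring of `ViaEndo F` is `R`. -/
def ViaEndo.ofBase {R : Type u} [CommRing R] (F : R →+* R) : R ≃+* ViaEndo F :=
  RingEquiv.refl R

/-- The base change `A' = R ⊗_{F, R} A` of the `R`-algebra `A` along `F : R → R`; here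
`r ⊗ (s • a) = (r * F s) ⊗ a`. -/
def FrobTwist {R : Type u} [CommRing R] (F : R →+* R) (A : Type v) [CommRing A] [Algebra R A] :
    Type (max u v) :=
  ViaEndo F ⊗[R] A

instance FrobTwist.instCommRing {R : Type u} [CommRing R] (F : R →+* R) (A : Type v) [CommRing A]
    [Algebra R A] : CommRing (FrobTwist F A) :=
  inferInstanceAs (CommRing (ViaEndo F ⊗[R] A))

/-- `A'` is an `R`-algebra through the left factor: `r ↦ r ⊗ 1`. -/
instance FrobTwist.instAlgebra {R : Type u} [CommRing R] (F : R →+* R) (A : Type v) [CommRing A]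
    [Algebra R A] : Algebra R (FrobTwist F A) :=
  RingHom.toAlgebra (S := FrobTwist F A)
    ((Algebra.TensorProduct.includeLeftRingHom : ViaEndo F →+* ViaEndo F ⊗[R] A).comp
      (ViaEndo.ofBase F).toRingHom)

/-- The element `1 ⊗ a` of `A' = R ⊗_{F, R} A`. -/
def FrobTwist.of {R : Type u} [CommRing R] (F : R →+* R) {A : Type v} [CommRing A] [Algebra R A]
    (a : A) : FrobTwist F A :=
  (1 : ViaEndo F) ⊗ₜ[R] a

/-- `φ` makes `A` a finite locally free `B`-module of rank `n` (a finitely generated projective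
`B`-module whose rank is `n` at each prime of `B`). -/
def IsLocallyFreeOfRank {B : Type u} {A : Type v} [CommRing B] [CommRing A] (φ : B →+* A) (n : ℕ) :
    Prop :=
  letI := φ.toAlgebra
  Module.Finite B A ∧ Module.Projective B A ∧
    ∀ P : PrimeSpectrum B, Module.rankAtStalk (R := B) A P = n

/-- `d` is a `σ`-derivation of the `R`-algebra `A` (it is `R`-linear and satisfies the twisted
Leibniz rule) which takes the value `1` at the coordinate `x`. -/
def IsSigmaDerivation {R : Type u} [CommRing R] {A : Type v} [CommRing A] [Algebra R A]
    (σ : A →ₐ[R] A) (x : A) (d : A →ₗ[R] A) : Prop :=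
  (∀ z₁ z₂ : A, d (z₁ * z₂) = d z₁ * z₂ + σ z₁ * d z₂) ∧ d x = 1

/-- The map `∇ : M → M ⊗_A Ω¹_{A/R}`, `m ↦ d m ⊗ dx`. -/
def qNabla {R : Type u} [CommRing R] {A : Type v} [CommRing A] [Algebra R A] (x : A)
    {M : Type v} [AddCommGroup M] [Module A M] [Module R M] [IsScalarTower R A M]
    (d : M →ₗ[R] M) : M →ₗ[R] M ⊗[A] Ω[A⁄R] :=
  (((TensorProduct.mk A M Ω[A⁄R]).flip (KaehlerDifferential.D R A x)).restrictScalars R) ∘ₗ d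

/-- The `q`-de Rham complex `0 → M → M ⊗_A Ω¹_{A/R} → 0` of `R`-modules attached to an `A`-module
`M` with its `σ`-derivation `d`; it sits in degrees `0` and `1`, with differential
`m ↦ d m ⊗ dx`. -/
def qDeRham {R : Type u} [CommRing R] {A : Type v} [CommRing A] [Algebra R A] (x : A)
    (M : Type v) [AddCommGroup M] [Module A M] [Module R M] [IsScalarTower R A M]
    (d : M →ₗ[R] M) : CochainComplex (ModuleCat.{v} R) ℕ :=
  HomologicalComplex.double (c := ComplexShape.up ℕ) (i₀ := 0) (i₁ := 1)
    (ModuleCat.ofHom (qNabla x d)) rfl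

end

/-! Write B = A' and y = 1 ⊗ x, so that F^* sends y to x^p. The main point is that 1, x, …, x^(p-1)
is a basis of A over B (`exists_basis_pow_of_etale`). The q-derivative is then the B-linear map x^i
↦ (i)_q x^(i-1). Since (p)_q = 0, the elements (1)_q, …, (p-1)_q are units (`isUnit_qNumber`), so
its kernel is B and its image consists of the elements without x^(p-1) term; the cokernel is again
B. As B is étale over R[y], its differentials are free on dy, so its exterior powers are B, B, 0, 0,
…, matching the cohomology.

For the basis, compare A with C = B[T]/(T^p - y). The map C → A, T ↦ x, is flat, and both sides have
rank p over B, so it suffices to prove surjectivity on the fibers over the residue fields K of B. If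
q ≠ 1 and y ≠ 0 in K, the powers of x are eigenvectors of σ with distinct eigenvalues. Otherwise the
fiber of C is local, and a flat map from it to a nonzero algebra of the same dimension is injective,
hence bijective. -/

/-! ### Algebras over a field, and surjectivity on fibers -/

section Fibers

/-- An algebra over a field `K` generated by a `p`-th root of `c ∈ K` is local, if `c = 0` or `K` has
characteristic `p`. -/
theorem isLocalRing_of_adjoin_pow_eq {K D : Type*} [Field K] [CommRing D] [Nontrivial D]
    [Algebra K D] {p : ℕ} (hp : p.Prime) {T : D} (hT : Algebra.adjoin K {T} = ⊤) {c : K}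
    (hc : T ^ p = algebraMap K D c) (h : c = 0 ∨ (p : K) = 0) : IsLocalRing D := by
  suffices H : ∀ u : D, IsUnit u ∨ IsNilpotent u from
    .of_isUnit_or_isUnit_one_sub_self fun u => (H u).imp_right fun hu => hu.isUnit_one_sub
  intro u
  rcases h with rfl | h
  · have hnil : IsNilpotent T := ⟨p, by simp [hc]⟩
    -- Modulo the nilpotent generator T, every element is a constant.
    have key : ∃ k : K, IsNilpotent (u - algebraMap K D k) := by
      have hu : u ∈ Algebra.adjoin K {T} := hT ▸ Algebra.mem_top
      induction hu using Algebra.adjoin_induction with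
      | mem z hz => exact ⟨0, by rw [Set.mem_singleton_iff.mp hz]; simpa using hnil⟩
      | algebraMap k => exact ⟨k, by simp⟩
      | add a b _ _ ha hb =>
        obtain ⟨k, hk⟩ := ha
        obtain ⟨l, hl⟩ := hb
        refine ⟨k + l, ?_⟩
        have := (Commute.all _ _).isNilpotent_add hk hl
        convert this using 1
        rw [map_add]; ring
      | mul a b _ _ ha hb =>
        obtain ⟨k, hk⟩ := ha
        obtain ⟨l, hl⟩ := hb
        refine ⟨k * l, ?_⟩
        have := (Commute.all _ _).isNilpotent_add
          ((Commute.all _ b).isNilpotent_mul_right hk)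
          ((Commute.all _ (algebraMap K D k)).isNilpotent_mul_right hl)
        convert this using 1
        rw [map_mul]; ring
    obtain ⟨k, hk⟩ := key
    rcases eq_or_ne k 0 with rfl | hk0
    · exact .inr (by simpa using hk)
    · left
      have := hk.isUnit_add_left_of_commute ((IsUnit.mk0 k hk0).map (algebraMap K D))
        (Commute.all _ _)
      simpa using this
  · have : Fact p.Prime := ⟨hp⟩
    have : CharP D p := by
      have : CharP K p := (CharP.charP_iff_prime_eq_zero hp).mpr h
      exact charP_of_injective_algebraMap (algebraMap K D).injective p
    -- Additivity of Frobenius carries T ^ p ∈ K over to all of D.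
    have key : ∃ k : K, u ^ p = algebraMap K D k := by
      have hu : u ∈ Algebra.adjoin K {T} := hT ▸ Algebra.mem_top
      induction hu using Algebra.adjoin_induction with
      | mem z hz => exact ⟨c, by rw [Set.mem_singleton_iff.mp hz, hc]⟩
      | algebraMap k => exact ⟨k ^ p, by simp⟩
      | add a b _ _ ha hb =>
        obtain ⟨k, hk⟩ := ha
        obtain ⟨l, hl⟩ := hb
        exact ⟨k + l, by rw [add_pow_char, hk, hl, map_add]⟩
      | mul a b _ _ ha hb =>
        obtain ⟨k, hk⟩ := ha
        obtain ⟨l, hl⟩ := hb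
        exact ⟨k * l, by rw [mul_pow, hk, hl, map_mul]⟩
    obtain ⟨k, hk⟩ := key
    rcases eq_or_ne k 0 with rfl | hk0
    · exact .inr ⟨p, by simp [hk]⟩
    · left
      have := (IsUnit.mk0 k hk0).map (algebraMap K D)
      rw [← hk] at this
      exact (isUnit_pow_iff hp.ne_zero).mp this

/-- A flat homomorphism from a local `K`-algebra to a nonzero one of the same finite dimension is
surjective. -/
theorem AlgHom.surjective_of_flat_of_finrank_eq {K D E : Type*} [Field K] [CommRing D]
    [CommRing E] [Algebra K D] [Algebra K E] [IsLocalRing D] [Nontrivial E] [Module.Finite K D]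
    [Module.Finite K E] (g : D →ₐ[K] E) (hg : g.toRingHom.Flat)
    (h : Module.finrank K D = Module.finrank K E) : Function.Surjective g := by
  algebraize [g.toRingHom]
  have : Module.Finite D E := .of_restrictScalars_finite K D E
  -- Free and nonzero, hence faithful: this gives injectivity.
  have : Module.Free D E := Module.free_of_flat_of_isLocalRing
  have hinj : Function.Injective g := FaithfulSMul.algebraMap_injective D E
  exact (LinearMap.injective_iff_surjective_of_finrank_eq_finrank (f := g.toLinearMap) h).mp hinj

/-- In an algebra of dimension `p`, the powers of a unit that is an eigenvector of an endomorphism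
with eigenvalue a primitive `p`-th root of unity generate. -/
theorem span_pow_eq_top_of_isPrimitiveRoot {K E : Type*} [Field K] [CommRing E] [Nontrivial E]
    [Algebra K E] {p : ℕ} (hE : Module.finrank K E = p) (hp0 : p ≠ 0) {q : K}
    (hq : IsPrimitiveRoot q p)
    (τ : E →ₐ[K] E) {x : E} (hx : IsUnit x) (hτ : τ x = q • x) :
    Submodule.span K (Set.range fun i : Fin p => x ^ (i : ℕ)) = ⊤ := by
  have hli : LinearIndependent K fun i : Fin p => x ^ (i : ℕ) := by
    refine Module.End.eigenvectors_linearIndependent' τ.toLinearMap (fun i : Fin p => q ^ (i : ℕ))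
      ?_ _ fun i => ?_
    · intro i j hij
      exact Fin.ext (hq.pow_inj i.2 j.2 hij)
    · refine Module.End.hasEigenvector_iff.mpr ⟨Module.End.mem_eigenspace_iff.mpr ?_, ?_⟩
      · simp [hτ, _root_.smul_pow]
      · exact (hx.pow _).ne_zero
  have : Nonempty (Fin p) := ⟨⟨0, Nat.pos_of_ne_zero hp0⟩⟩
  exact hli.span_eq_top_of_card_eq_finrank (by simp [hE])

/-- Surjectivity onto a finite module is detected on the fibers. -/
theorem LinearMap.surjective_of_surjective_baseChange_residueField {B M N : Type*} [CommRing B]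
    [AddCommGroup M] [Module B M] [AddCommGroup N] [Module B N] [Module.Finite B N]
    (g : M →ₗ[B] N)
    (h : ∀ m : PrimeSpectrum B, Function.Surjective (g.baseChange m.asIdeal.ResidueField)) :
    Function.Surjective g := by
  rw [← LinearMap.range_eq_top, ← Submodule.Quotient.subsingleton_iff,
    ← Module.support_eq_empty_iff (R := B), Set.eq_empty_iff_forall_notMem]
  intro m hm
  rw [Module.mem_support_iff_nontrivial_residueField_tensorProduct] at hm
  refine not_subsingleton_iff_nontrivial.mpr hm ?_
  let K := m.asIdeal.ResidueField
  have h1 : Function.Surjective ((LinearMap.range g).mkQ.baseChange K) :=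
    LinearMap.lTensor_surjective _ (Submodule.mkQ_surjective _)
  -- This composite is zero and also surjective, so the fiber of the cokernel vanishes.
  have h2 : (LinearMap.range g).mkQ.baseChange K ∘ₗ g.baseChange K = 0 := by
    rw [← LinearMap.baseChange_comp, LinearMap.range_mkQ_comp, LinearMap.baseChange_zero]
  refine ⟨fun a b => ?_⟩
  obtain ⟨a, rfl⟩ := (h1.comp (h m)) a
  obtain ⟨b, rfl⟩ := (h1.comp (h m)) b
  exact (LinearMap.congr_fun h2 a).trans (LinearMap.congr_fun h2 b).symm

end Fibers

/-! ### The basis of powers of the coordinate -/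

section Basis

/-- Cancellation: in a commutative square of rings `P → Q → A`, `P → B → A` with `P → B` and
`Q → A` étale, the map `B ⊗[P] Q → A` is flat. -/
theorem flat_lift_of_etale {P Q B A : Type*} [CommRing P] [CommRing Q] [CommRing B] [CommRing A]
    [Algebra P Q] [Algebra P B] [Algebra P A] [Algebra Q A] [Algebra B A] [IsScalarTower P Q A]
    [IsScalarTower P B A] [Algebra.Etale P B] [Algebra.Etale Q A] :
    (Algebra.TensorProduct.lift (Algebra.ofId B A) (IsScalarTower.toAlgHom P Q A)
      (fun _ _ => Commute.all _ _) : B ⊗[P] Q →ₐ[B] A).toRingHom.Flat := by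
  set φ : B ⊗[P] Q →ₐ[B] A := Algebra.TensorProduct.lift (Algebra.ofId B A)
    (IsScalarTower.toAlgHom P Q A) (fun _ _ => Commute.all _ _) with hφ
  -- With the factors swapped, source and target are both étale over Q, so the map between them is
  -- étale.
  let ψ : Q ⊗[P] B →ₐ[Q] A := Algebra.TensorProduct.lift (Algebra.ofId Q A)
    (IsScalarTower.toAlgHom P B A) (fun _ _ => Commute.all _ _)
  have hψ : ψ.toRingHom.Flat := by
    algebraize [ψ.toRingHom]
    have : IsScalarTower Q (Q ⊗[P] B) A := .of_algebraMap_eq' ψ.comp_algebraMap.symm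
    have : Algebra.Etale (Q ⊗[P] B) A := .of_restrictScalars Q _ _
    exact (inferInstance : Module.Flat (Q ⊗[P] B) A)
  have : φ.toRingHom = ψ.toRingHom.comp (Algebra.TensorProduct.comm P B Q).toRingHom := by
    have : φ.restrictScalars P = (ψ.restrictScalars P).comp
        (Algebra.TensorProduct.comm P B Q).toAlgHom := by
      ext <;> simp [φ, ψ]
    exact congr(($this).toRingHom)
  rw [this]
  exact .comp (.of_bijective (Algebra.TensorProduct.comm P B Q).bijective) hψ

theorem RingHom.Etale.comp_ringEquiv {S T U : Type*} [CommRing S] [CommRing T] [CommRing U]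
    {g : T →+* U} (hg : g.Etale) (e : S ≃+* T) : (g.comp (e : S →+* T)).Etale := by
  algebraize [g, (e : S →+* T), g.comp (e : S →+* T)]
  have : Algebra.Etale S T := RingHom.Etale.of_bijective (f := (e : S →+* T)) e.bijective
  exact Algebra.Etale.comp S T U

/-- The polynomial ring `R[X]` is obtained from its subring `R[X ^ p]` by adjoining a `p`-th root
of the coordinate. -/
noncomputable def polynomialEquivAdjoinRoot (R : Type*) [CommRing R] (p : ℕ) :
    R[X] ≃ₐ[R] AdjoinRoot (X ^ p - C X : R[X][X]) :=
  .ofAlgHom (aeval (AdjoinRoot.root _))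
    (AdjoinRoot.liftAlgHom _ (expand R p) X (by simp [eval₂_sub, eval₂_pow]))
    (by
      ext
      · have := AdjoinRoot.eval₂_root (X ^ p - C X : R[X][X])
        simp only [eval₂_sub, eval₂_X_pow, eval₂_C, sub_eq_zero] at this
        simpa using this
      · simp)
    (by ext; simp)

theorem pow_eq_one_of_qNumber_eq_zero {R : Type*} [CommRing R] {q : R} {p : ℕ}
    (hq : qNumber q p = 0) : q ^ p = 1 := by
  have := mul_geom_sum q p
  rw [show ∑ i ∈ Finset.range p, q ^ i = 0 from hq, mul_zero] at this
  exact (sub_eq_zero.mp this.symm)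

variable {R : Type*} [CommRing R] {A B : Type*} [CommRing A] [CommRing B] [Algebra R A]
  [Algebra R B] [Algebra B A] [IsScalarTower R B A]

/-- Let `q` be a root of the `p`-th cyclotomic `q`-number in `R`, and let `A` be an algebra of rank
`p` over `B`, both étale over the line with coordinates `x` and `y ↦ x ^ p`. If multiplication of
the coordinate by `q` lifts to a `B`-linear endomorphism of `A`, then `1, x, …, x ^ (p - 1)` is a
basis of the `B`-module `A`. -/
theorem exists_basis_pow_of_etale {p : ℕ} (hp : p.Prime) {q : R} (hq : qNumber q p = 0)
    (x : A) (y : B) (hxy : algebraMap B A y = x ^ p)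
    (hx : (aeval x : R[X] →ₐ[R] A).toRingHom.Etale)
    (hy : (aeval y : R[X] →ₐ[R] B).toRingHom.Etale)
    [Module.Finite B A] [Module.Projective B A]
    (hr : ∀ P : PrimeSpectrum B, Module.rankAtStalk (R := B) A P = p)
    (σ : A →ₐ[B] A) (hσ : σ x = q • x) :
    ∃ b : Module.Basis (Fin p) B A, ∀ i, b i = x ^ (i : ℕ) := by
  rcases subsingleton_or_nontrivial R with hR | hR
  · have : Subsingleton B := Module.subsingleton R B
    have : Subsingleton A := Module.subsingleton R A
    exact ⟨.ofRepr ⟨0, 0, fun _ => Subsingleton.elim _ _, fun _ => Subsingleton.elim _ _⟩,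
      fun _ => Subsingleton.elim _ _⟩
  let P := R[X]
  let g : P[X] := X ^ p - C (X : P)
  have hg : g.Monic := monic_X_pow_sub_C _ hp.ne_zero
  have hgd : g.natDegree = p := natDegree_X_pow_sub_C
  let Q := AdjoinRoot g
  let : Algebra P B := (aeval y : R[X] →ₐ[R] B).toRingHom.toAlgebra
  let : Algebra P A := ((algebraMap B A).comp (algebraMap P B)).toAlgebra
  have : IsScalarTower P B A := .of_algebraMap_eq' rfl
  let l : Q →ₐ[P] A := AdjoinRoot.liftAlgHom g (Algebra.ofId P A) x (by
    simp only [g, eval₂_sub, eval₂_X_pow, eval₂_C, sub_eq_zero]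
    change x ^ p = algebraMap B A (aeval y X)
    rw [aeval_X, hxy])
  let : Algebra Q A := l.toRingHom.toAlgebra
  have : IsScalarTower P Q A := .of_algebraMap_eq' l.comp_algebraMap.symm
  have : Algebra.Etale P B := hy
  -- Under Q ≅ R[X], the root of g corresponds to X, and Q → A becomes the étale map X ↦ x.
  have : Algebra.Etale Q A := by
    rw [← RingHom.etale_algebraMap]
    have : algebraMap Q A = (aeval x : R[X] →ₐ[R] A).toRingHom.comp
        ((polynomialEquivAdjoinRoot R p).symm.toRingEquiv : Q →+* R[X]) := by
      have hl : ((algebraMap Q A).comp (algebraMap R Q)) = algebraMap R A := by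
        ext r
        change l (algebraMap R Q r) = _
        rw [IsScalarTower.algebraMap_apply R P Q, AlgHom.commutes]
        change algebraMap B A (aeval y (C r)) = _
        rw [aeval_C, ← IsScalarTower.algebraMap_apply]
      let l' : Q →ₐ[R] A := { l.toRingHom with commutes' := RingHom.congr_fun hl }
      have key : l'.comp (polynomialEquivAdjoinRoot R p).toAlgHom = aeval x := by
        refine Polynomial.algHom_ext ?_
        change l (aeval (AdjoinRoot.root g) X) = _
        rw [aeval_X, aeval_X]
        exact AdjoinRoot.liftAlgHom_root ..
      refine RingHom.ext fun z => ?_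
      obtain ⟨w, rfl⟩ := (polynomialEquivAdjoinRoot R p).surjective z
      refine (DFunLike.congr_fun key w).trans ?_
      change _ = aeval x ((polynomialEquivAdjoinRoot R p).symm _)
      rw [AlgEquiv.symm_apply_apply]
    rw [this]
    exact hx.comp_ringEquiv (polynomialEquivAdjoinRoot R p).symm.toRingEquiv
  let φ : B ⊗[P] Q →ₐ[B] A := Algebra.TensorProduct.lift (Algebra.ofId B A)
    (IsScalarTower.toAlgHom P Q A) (fun _ _ => Commute.all _ _)
  have hφ : φ.toRingHom.Flat := flat_lift_of_etale
  let bQ : Module.Basis (Fin p) P Q := (AdjoinRoot.powerBasis' hg).basis.reindex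
    (finCongr (hgd ▸ AdjoinRoot.powerBasis'_dim hg))
  have hbQ : ∀ i, bQ i = AdjoinRoot.root g ^ (i : ℕ) := fun i => by
    rw [Module.Basis.reindex_apply, PowerBasis.basis_eq_pow]
    rfl
  let bC : Module.Basis (Fin p) B (B ⊗[P] Q) := bQ.baseChange B
  have hbC : ∀ i, φ (bC i) = x ^ (i : ℕ) := fun i => by
    have : algebraMap Q A (AdjoinRoot.root g) = x := AdjoinRoot.liftAlgHom_root ..
    simp [bC, hbQ, φ, this]
  have hfin : Module.Finite B (B ⊗[P] Q) := .of_basis bC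
  have hfree : Module.Free B (B ⊗[P] Q) := .of_basis bC
  have hsurj : Function.Surjective φ.toLinearMap := by
    refine LinearMap.surjective_of_surjective_baseChange_residueField _ fun m => ?_
    let K := m.asIdeal.ResidueField
    have hE : Module.finrank K (K ⊗[B] A) = p := by
      rw [← hr m]; exact Ideal.finrank_fiber_eq_rankAtStalk m.asIdeal
    have : Nontrivial B := (algebraMap B K).domain_nontrivial
    have hD : Module.finrank K (K ⊗[B] (B ⊗[P] Q)) = p := by
      rw [Module.finrank_baseChange, Module.finrank_eq_card_basis bC, Fintype.card_fin]
    have : Nontrivial (K ⊗[B] A) :=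
      Module.nontrivial_of_finrank_pos (R := K) (hE ▸ hp.pos)
    have : Nontrivial (K ⊗[B] (B ⊗[P] Q)) :=
      Module.nontrivial_of_finrank_pos (R := K) (hD ▸ hp.pos)
    let G : K ⊗[B] (B ⊗[P] Q) →ₐ[K] K ⊗[B] A := Algebra.TensorProduct.lTensor K φ
    change Function.Surjective G
    let ι : R →+* K := (algebraMap B K).comp (algebraMap R B)
    have hqK : ∑ i ∈ Finset.range p, ι q ^ i = 0 := by
      simpa [qNumber] using congr(ι $hq)
    by_cases hcase : ι q ≠ 1 ∧ algebraMap B K y ≠ 0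
    · have hprim : IsPrimitiveRoot (ι q) p := by
        have : Fact p.Prime := ⟨hp⟩
        rw [← orderOf_eq_prime (pow_eq_one_of_qNumber_eq_zero hqK) hcase.1]
        exact .orderOf _
      let ξ : K ⊗[B] A := 1 ⊗ₜ x
      have hξ : IsUnit ξ := by
        rw [← isUnit_pow_iff hp.ne_zero]
        convert (IsUnit.mk0 _ hcase.2).map (algebraMap K (K ⊗[B] A)) using 1
        simp [ξ, ← hxy, Algebra.algebraMap_eq_smul_one, Algebra.TensorProduct.one_def]
      have htop := span_pow_eq_top_of_isPrimitiveRoot hE hp.ne_zero hprim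
        (Algebra.TensorProduct.map (AlgHom.id K K) σ) hξ (by
          have : q • x = algebraMap R B q • x := by rw [algebraMap_smul]
          change (1 : K) ⊗ₜ[B] σ x = _
          rw [hσ, this, TensorProduct.tmul_smul, ← algebraMap_smul K (algebraMap R B q)]
          rfl)
      rw [← AlgHom.coe_toLinearMap, ← LinearMap.range_eq_top, ← top_le_iff, ← htop,
        Submodule.span_le]
      rintro _ ⟨i, rfl⟩
      exact ⟨1 ⊗ₜ bC i, by simp [G, hbC, ξ]⟩
    -- Here q = 1 or y = 0 in K. The fiber is generated by a p-th root T of y, and q = 1 turns (p)_q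
    -- = 0 into p = 0.
    · let T : K ⊗[B] (B ⊗[P] Q) := 1 ⊗ₜ (1 ⊗ₜ AdjoinRoot.root g)
      have hT : T ^ p = algebraMap K _ (algebraMap B K y) := by
        have h1 : AdjoinRoot.root g ^ p = (X : P) • (1 : Q) := by
          have := AdjoinRoot.eval₂_root g
          simp only [g, eval₂_sub, eval₂_X_pow, eval₂_C, sub_eq_zero] at this
          rw [Algebra.smul_def, mul_one]
          exact this
        have h2 : (X : P) • (1 : B) = y • (1 : B) := by
          rw [Algebra.smul_def, smul_eq_mul]
          exact congr($(aeval_X (R := R) y) * 1)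
        simp only [T, Algebra.TensorProduct.tmul_pow, one_pow, h1]
        rw [← TensorProduct.smul_tmul, h2, ← TensorProduct.smul_tmul',
          ← TensorProduct.smul_tmul, Algebra.TensorProduct.algebraMap_apply,
          ← Algebra.algebraMap_eq_smul_one]
        rfl
      have hTtop : Algebra.adjoin K {T} = ⊤ := by
        rw [← Algebra.toSubmodule_eq_top, ← top_le_iff, ← (bC.baseChange K).span_eq,
          Submodule.span_le]
        rintro _ ⟨i, rfl⟩
        have : (bC.baseChange K) i = T ^ (i : ℕ) := by simp [bC, hbQ, T]
        rw [this]
        exact pow_mem (Algebra.self_mem_adjoin_singleton K T) _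
      have : IsLocalRing (K ⊗[B] (B ⊗[P] Q)) := by
        refine isLocalRing_of_adjoin_pow_eq hp hTtop hT ?_
        by_cases hy0 : algebraMap B K y = 0
        · exact .inl hy0
        · right
          have h1 : ι q = 1 := by tauto
          simpa [h1] using hqK
      exact G.surjective_of_flat_of_finrank_eq (RingHom.Flat.lTensor (S := K) K hφ)
        (hD.trans hE.symm)
  -- A surjection between projective modules of equal rank is bijective.
  have hbij : Function.Bijective φ.toLinearMap := by
    refine Module.bijective_of_surjective_of_rankAtStalk_eq hsurj fun m _ => ?_
    have : Nontrivial B := ⟨0, 1, fun h =>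
      ‹m.IsMaximal›.ne_top ((Ideal.eq_top_iff_one m).mpr (h ▸ m.zero_mem))⟩
    rw [hr, Module.rankAtStalk_eq_finrank_of_free, Module.finrank_eq_card_basis bC]
    simp
  exact ⟨bC.map (.ofBijective _ hbij), hbC⟩

end Basis

/-! ### Arithmetic of q-numbers -/

section QNumber

variable {R : Type*} [CommRing R]

theorem qNumber_add (q : R) (m n : ℕ) :
    qNumber q (m + n) = qNumber q m + q ^ m * qNumber q n := by
  simp [qNumber, Finset.sum_range_add, Finset.mul_sum, pow_add]

theorem qNumber_dvd_qNumber_mul (q : R) (m n : ℕ) : qNumber q m ∣ qNumber q (m * n) := by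
  induction n with
  | zero => simp [qNumber]
  | succ n ih => rw [Nat.mul_succ, qNumber_add]; exact dvd_add ih (Dvd.intro_left _ rfl)

/-- If `(p)_q = 0`, then `(m)_q` is invertible for `m` prime to `p`. -/
theorem isUnit_qNumber {q : R} {p m : ℕ} (hp : p.Prime) (hq : qNumber q p = 0)
    (hm : m.Coprime p) : IsUnit (qNumber q m) := by
  obtain ⟨k, -, hk⟩ := Nat.exists_mul_mod_eq_one_of_coprime hm hp.one_lt
  -- (n)_q depends only on n mod p, and (m)_q divides (m * k)_q.
  have h1 : qNumber q (m * k) = 1 := by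
    have h0 : qNumber q (p * (m * k / p)) = 0 :=
      zero_dvd_iff.mp (hq ▸ qNumber_dvd_qNumber_mul q p _)
    rw [← Nat.mod_add_div (m * k) p, hk, qNumber_add, h0]
    simp [qNumber]
  exact isUnit_of_dvd_one (h1 ▸ qNumber_dvd_qNumber_mul q m k)

end QNumber

/-! ### The q-derivative: twisted Leibniz rule, kernel and image -/

section SigmaDerivation

variable {R : Type*} [CommRing R] {A B : Type*} [CommRing A] [CommRing B] [Algebra R A]
  [Algebra B A]

/-- The `B`-linear map with `x ^ i ↦ (i)_q x ^ (i - 1)`, where `1, x, …, x ^ (p - 1)` is a basis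
of `A` over `B`. -/
noncomputable def qDerivative {p : ℕ} (q : R) (x : A) (b : Module.Basis (Fin p) B A) : A →ₗ[B] A :=
  -- At i = 0 the truncated exponent is harmless, because (0)_q = 0.
  b.constr B fun i => qNumber q i • x ^ ((i : ℕ) - 1)

variable {p : ℕ} (hp : p.Prime) {q : R} (hq : qNumber q p = 0) {x : A} {y : B}
  (hxy : algebraMap B A y = x ^ p) {b : Module.Basis (Fin p) B A}
  (hb : ∀ i, b i = x ^ (i : ℕ))

include hb in
theorem qDerivative_pow_of_lt {n : ℕ} (hn : n < p) :
    qDerivative q x b (x ^ n) = qNumber q n • x ^ (n - 1) := by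
  have := b.constr_basis B (fun i => qNumber q i • x ^ ((i : ℕ) - 1)) ⟨n, hn⟩
  rwa [hb] at this

variable [Algebra R B] [IsScalarTower R B A]

-- Beyond the basis range, x ^ p = y is a scalar and (p + m)_q = (m)_q, so the formula is periodic.
include hp hb hq hxy in
theorem qDerivative_pow (n : ℕ) :
    qDerivative q x b (x ^ n) = qNumber q n • x ^ (n - 1) := by
  induction n using Nat.strong_induction_on with
  | _ n ih =>
    rcases lt_or_ge n p with hn | hn
    · exact qDerivative_pow_of_lt hb hn
    · obtain ⟨m, rfl⟩ := Nat.exists_eq_add_of_le hn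
      have h1 : x ^ (p + m) = y • x ^ m := by rw [pow_add, Algebra.smul_def, hxy]
      rw [h1, map_smul, ih m (by have := hp.pos; omega), qNumber_add, hq,
        pow_eq_one_of_qNumber_eq_zero hq, zero_add, one_mul, smul_comm, Algebra.smul_def y, hxy]
      rcases m with _ | m
      · simp [qNumber]
      · rw [← pow_add]; rfl

-- Both sides are B-bilinear; on powers of x the rule is (i + j)_q = (i)_q + q ^ i (j)_q.
include hp hb hq hxy in
theorem qDerivative_mul (σ : A →ₐ[B] A) (hσ : σ x = q • x) (z₁ z₂ : A) :
    qDerivative q x b (z₁ * z₂) =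
      qDerivative q x b z₁ * z₂ + σ z₁ * qDerivative q x b z₂ := by
  set d := qDerivative q x b
  have key : (LinearMap.mul B A).compr₂ d = (LinearMap.mul B A).comp d +
      ((LinearMap.mul B A).compl₂ d).comp σ.toLinearMap := by
    refine b.ext fun i => b.ext fun j => ?_
    have hd := qDerivative_pow hp hq hxy hb
    simp only [hb, LinearMap.compr₂_apply, LinearMap.mul_apply', LinearMap.add_apply,
      LinearMap.comp_apply, LinearMap.compl₂_apply, AlgHom.toLinearMap_apply, map_pow, hσ,
      ← pow_add, d, hd, qNumber_add, _root_.smul_pow]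
    obtain ⟨i, hi⟩ := i
    obtain ⟨j, hj⟩ := j
    rcases i with _ | i
    · simp [qNumber]
    rcases j with _ | j
    · simp [qNumber]
    simp only [Nat.add_sub_cancel, ← add_assoc, Algebra.smul_def, map_add, map_mul, map_pow]
    ring
  exact LinearMap.congr_fun₂ key z₁ z₂

include hp hb hq hxy in
theorem isSigmaDerivation_qDerivative (σ : A →ₐ[R] A) (hσ : σ x = q • x)
    (hσB : ∀ c : B, σ (algebraMap B A c) = algebraMap B A c) :
    IsSigmaDerivation σ x ((qDerivative q x b).restrictScalars R) := by
  refine ⟨qDerivative_mul hp hq hxy hb { σ with commutes' := hσB } hσ, ?_⟩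
  have := qDerivative_pow hp hq hxy hb 1
  simpa [qNumber] using this

include hb in
/-- The coefficient of `x ^ j` in the `q`-derivative. -/
theorem coord_qDerivative {j : ℕ} (hj : j + 1 < p) (a : A) :
    b.coord ⟨j, by omega⟩ (qDerivative q x b a) = qNumber q (j + 1) • b.coord ⟨j + 1, hj⟩ a := by
  have key : b.coord ⟨j, by omega⟩ ∘ₗ qDerivative q x b =
      algebraMap R B (qNumber q (j + 1)) • b.coord ⟨j + 1, hj⟩ := by
    refine b.ext fun ⟨k, hk⟩ => ?_
    rw [LinearMap.comp_apply, hb, qDerivative_pow_of_lt hb hk, ← algebraMap_smul B, map_smul,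
      LinearMap.smul_apply, ← hb ⟨k, hk⟩,
      show x ^ (k - 1) = b ⟨k - 1, by omega⟩ from (hb ⟨k - 1, _⟩).symm]
    rcases k with _ | k
    · simp [qNumber, Finsupp.single_apply]
    · by_cases hkj : k = j
      · subst hkj; simp
      · simp [hkj]
  simpa using LinearMap.congr_fun key a

include hb in
theorem coord_last_qDerivative (h : p - 1 < p) (a : A) :
    b.coord ⟨p - 1, h⟩ (qDerivative q x b a) = 0 := by
  have key : b.coord ⟨p - 1, h⟩ ∘ₗ qDerivative q x b = 0 := by
    refine b.ext fun ⟨k, hk⟩ => ?_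
    rw [LinearMap.comp_apply, hb, qDerivative_pow_of_lt hb hk, ← algebraMap_smul B, map_smul,
      show x ^ (k - 1) = b ⟨k - 1, by omega⟩ from (hb ⟨k - 1, _⟩).symm]
    rcases k with _ | k
    · simp [qNumber]
    · have : ¬ k = p - 1 := by omega
      simp [this]
  exact LinearMap.congr_fun key a

include hp hq hb in
theorem ker_qDerivative :
    LinearMap.ker (qDerivative q x b) = LinearMap.range (Algebra.linearMap B A) := by
  ext a
  constructor
  · intro ha
    rw [LinearMap.mem_ker] at ha
    refine ⟨b.coord ⟨0, hp.pos⟩ a, ?_⟩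
    conv_rhs => rw [← b.sum_repr a]
    rw [Finset.sum_eq_single ⟨0, hp.pos⟩]
    · simp [hb, Algebra.smul_def]
    · rintro ⟨_ | j, hj⟩ _ h0
      · exact absurd rfl h0
      · have h1 := coord_qDerivative (q := q) hb hj a
        rw [ha, map_zero, ← algebraMap_smul B] at h1
        have hu := (isUnit_qNumber hp hq (Nat.coprime_of_lt_prime j.succ_ne_zero hj hp).symm).map
          (algebraMap R B)
        have h2 := (hu.smul_eq_zero).mp h1.symm
        rw [show b.repr a ⟨j + 1, hj⟩ = 0 from h2, zero_smul]
    · simp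
  · rintro ⟨c, rfl⟩
    have := qDerivative_pow_of_lt (q := q) hb hp.pos
    rw [LinearMap.mem_ker, Algebra.linearMap_apply, Algebra.algebraMap_eq_smul_one, map_smul,
      ← pow_zero x, this]
    simp [qNumber]

include hp hq hb in
theorem range_qDerivative (h : p - 1 < p) :
    LinearMap.range (qDerivative q x b) = LinearMap.ker (b.coord ⟨p - 1, h⟩) := by
  ext a
  constructor
  · rintro ⟨c, rfl⟩
    exact coord_last_qDerivative hb h c
  · intro ha
    rw [← b.sum_repr a]
    refine Submodule.sum_mem _ fun ⟨j, hj⟩ _ => ?_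
    by_cases hjp : j = p - 1
    · subst hjp
      rw [show b.repr a ⟨p - 1, hj⟩ = 0 from ha, zero_smul]
      exact zero_mem _
    · refine Submodule.smul_mem _ _ ?_
      have hj1 : j + 1 < p := by omega
      obtain ⟨w, hw⟩ := isUnit_qNumber hp hq
        (Nat.coprime_of_lt_prime j.succ_ne_zero hj1 hp).symm
      -- The q-antiderivative of x ^ j; it exists because j + 1 < p makes (j + 1)_q a unit.
      refine ⟨algebraMap R B (↑w⁻¹ : R) • x ^ (j + 1), ?_⟩
      rw [map_smul, qDerivative_pow_of_lt hb hj1, hb, algebraMap_smul, smul_smul, ← hw,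
        Units.inv_mul, one_smul]
      rfl

end SigmaDerivation

/-! ### Differentials and uniqueness of the σ-derivation -/

section Kaehler

variable {R : Type*} [CommRing R] {A : Type*} [CommRing A] [Algebra R A]

/-- The module of differentials of an algebra étale over the line with coordinate `x` is free
with basis `dx`. -/
theorem bijective_toSpanSingleton_D {x : A} (hx : (aeval x : R[X] →ₐ[R] A).toRingHom.Etale) :
    Function.Bijective (LinearMap.toSpanSingleton A Ω[A⁄R] (KaehlerDifferential.D R A x)) := by
  algebraize [(aeval x : R[X] →ₐ[R] A).toRingHom]
  have : IsScalarTower R R[X] A := .of_algebraMap_eq' (aeval x : R[X] →ₐ[R] A).comp_algebraMap.symm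
  let e := (TensorProduct.AlgebraTensorModule.rid R[X] A A).symm ≪≫ₗ
    TensorProduct.AlgebraTensorModule.congr (LinearEquiv.refl A A)
      (KaehlerDifferential.polynomialEquiv R).symm ≪≫ₗ
    KaehlerDifferential.tensorKaehlerEquivOfFormallyEtale R R[X] A
  have he : e.toLinearMap = LinearMap.toSpanSingleton A Ω[A⁄R] (KaehlerDifferential.D R A x) := by
    refine LinearMap.ext_ring ?_
    have : algebraMap R[X] A X = x := aeval_X x
    simp [e, this]
  rw [← he]
  exact e.bijective

/-- Two `σ`-derivations taking the value `1` at the étale coordinate `x` are equal. -/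
theorem IsSigmaDerivation.eq {x : A} (hx : (aeval x : R[X] →ₐ[R] A).toRingHom.Etale)
    {σ : A →ₐ[R] A} {d d' : A →ₗ[R] A} (hd : IsSigmaDerivation σ x d)
    (hd' : IsSigmaDerivation σ x d') : d = d' := by
  -- Expand d (x * z) = d (z * x) in both orders.
  have hσ (z : A) : σ z - z = d z * (σ x - x) := by
    have h1 := hd.1 x z
    rw [mul_comm x z, hd.1 z x, hd.2] at h1
    linear_combination h1
  have he (z w : A) : d (z * w) - d' (z * w) = (d z - d' z) * w + σ z * (d w - d' w) := by
    rw [hd.1, hd'.1]; ring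
  have hx0 (z : A) : (σ x - x) * (d z - d' z) = 0 := by
    have h1 := he x z
    rw [mul_comm x z, he z x, hd.2, hd'.2] at h1
    linear_combination -h1
  -- The difference is an ordinary derivation: σ z - z is a multiple of σ x - x, which kills d w -
  -- d' w. It vanishes at x, hence everywhere, as dx generates the differentials.
  let E : Derivation R A A := .mk' (d - d') fun z w => by
    simp only [LinearMap.sub_apply, smul_eq_mul, he]
    linear_combination (d w - d' w) * hσ z + d z * hx0 w
  have hE : E.liftKaehlerDifferential = 0 := by
    refine LinearMap.ext fun ω => ?_
    obtain ⟨a, rfl⟩ := (bijective_toSpanSingleton_D hx).2 ω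
    have : E x = 0 := by simp [E, hd.2, hd'.2]
    simp [this]
  ext z
  have : E z = 0 := by rw [← E.liftKaehlerDifferential_comp_D, hE]; rfl
  exact sub_eq_zero.mp this

end Kaehler

/-! ### Exterior powers of a cyclic module -/

section ExteriorPower

/-- The higher exterior powers of a module generated by one element vanish. -/
theorem subsingleton_exteriorPower_of_surjective {B M : Type*} [CommRing B] [AddCommGroup M]
    [Module B M] {w : M} (hw : Function.Surjective (LinearMap.toSpanSingleton B M w)) {n : ℕ}
    (hn : 2 ≤ n) : Subsingleton (⋀[B]^n M) := by
  rw [← Submodule.subsingleton_iff B, ← subsingleton_iff_bot_eq_top, eq_comm,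
    ← exteriorPower.ιMulti_span B n M, Submodule.span_eq_bot]
  rintro _ ⟨a, rfl⟩
  choose c hc using fun i => hw (a i)
  have : a = fun i => c i • w := by
    ext i; rw [← hc]; rfl
  rw [this, AlternatingMap.map_smul_univ,
    (exteriorPower.ιMulti B n).map_eq_zero_of_eq (fun _ => w) (i := ⟨0, by omega⟩)
      (j := ⟨1, by omega⟩) rfl (by simp), smul_zero]

end ExteriorPower

/-! ### Homology of a two-term complex -/

section Homology

variable {R : Type u} [CommRing R] {M N : Type v} [AddCommGroup M] [Module R M] [AddCommGroup N]
  [Module R N] (g : M →ₗ[R] N)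

/-- The complex `0 → M → N → 0` of `R`-modules, in degrees `0` and `1`. -/
noncomputable abbrev doubleComplex : CochainComplex (ModuleCat.{v} R) ℕ :=
  HomologicalComplex.double (c := ComplexShape.up ℕ) (i₀ := 0) (i₁ := 1) (ModuleCat.ofHom g) rfl

theorem nonempty_homology_zero_doubleComplex :
    Nonempty ((doubleComplex g).homology 0 ≃ₗ[R] LinearMap.ker g) := by
  let K := doubleComplex g
  let i₀ : K.X 0 ≅ ModuleCat.of R M := HomologicalComplex.doubleXIso₀ (ModuleCat.ofHom g) rfl
  let i₁ : K.X 1 ≅ ModuleCat.of R N :=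
    HomologicalComplex.doubleXIso₁ (ModuleCat.ofHom g) rfl zero_ne_one
  have h01 : K.d 0 1 = i₀.hom ≫ ModuleCat.ofHom g ≫ i₁.inv :=
    HomologicalComplex.double_d (ModuleCat.ofHom g) rfl zero_ne_one
  -- The predecessor of 0 in `ComplexShape.up ℕ` is 0 itself by convention, so the incoming map is
  -- `K.d 0 0`.
  have h00 : K.d 0 0 = 0 := HomologicalComplex.double_d_eq_zero₁ _ _ _ _ zero_ne_one
  let S : ShortComplex (ModuleCat.{v} R) :=
    ShortComplex.mk (0 : ModuleCat.of R M ⟶ ModuleCat.of R M) (ModuleCat.ofHom g)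
      Limits.zero_comp
  let e : K.sc' 0 0 1 ≅ S := ShortComplex.isoMk i₀ i₀ i₁
    (by
      change i₀.hom ≫ 0 = K.d 0 0 ≫ i₀.hom
      rw [h00, Limits.comp_zero, Limits.zero_comp])
    (by
      change i₀.hom ≫ ModuleCat.ofHom g = K.d 0 1 ≫ i₁.hom
      rw [h01, Category.assoc, Category.assoc, i₁.inv_hom_id, Category.comp_id])
  let e' : K.homology 0 ≅ S.homology :=
    ShortComplex.homologyMapIso (K.isoSc' 0 0 1 (by simp) (by simp) ≪≫ e)
  let e'' : S.homology ≅ ModuleCat.of R (LinearMap.ker g) :=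
    (S.asIsoHomologyπ rfl).symm ≪≫ S.moduleCatCyclesIso
  exact ⟨(e' ≪≫ e'').toLinearEquiv⟩

theorem nonempty_homology_one_doubleComplex :
    Nonempty ((doubleComplex g).homology 1 ≃ₗ[R] N ⧸ LinearMap.range g) := by
  let K := doubleComplex g
  let i₀ : K.X 0 ≅ ModuleCat.of R M := HomologicalComplex.doubleXIso₀ (ModuleCat.ofHom g) rfl
  let i₁ : K.X 1 ≅ ModuleCat.of R N :=
    HomologicalComplex.doubleXIso₁ (ModuleCat.ofHom g) rfl zero_ne_one
  have h01 : K.d 0 1 = i₀.hom ≫ ModuleCat.ofHom g ≫ i₁.inv :=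
    HomologicalComplex.double_d (ModuleCat.ofHom g) rfl zero_ne_one
  have h12 : K.d 1 2 = 0 := HomologicalComplex.double_d_eq_zero₀ _ _ _ _ one_ne_zero
  let S : ShortComplex (ModuleCat.{v} R) :=
    ShortComplex.mk (ModuleCat.ofHom g) (0 : ModuleCat.of R N ⟶ K.X 2)
      Limits.comp_zero
  let e : K.sc' 0 1 2 ≅ S := ShortComplex.isoMk i₀ i₁ (Iso.refl (K.X 2))
    (by
      change i₀.hom ≫ ModuleCat.ofHom g = K.d 0 1 ≫ i₁.hom
      rw [h01, Category.assoc, Category.assoc, i₁.inv_hom_id, Category.comp_id])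
    (by
      change i₁.hom ≫ 0 = K.d 1 2 ≫ 𝟙 (K.X 2)
      rw [h12, Limits.comp_zero, Limits.zero_comp])
  let e' : K.homology 1 ≅ S.homology :=
    ShortComplex.homologyMapIso (K.isoSc' 0 1 2 (by simp) (by simp) ≪≫ e)
  let e'' : S.homology ≅ ModuleCat.of R (N ⧸ LinearMap.range g) :=
    S.asIsoHomologyι rfl ≪≫ S.moduleCatOpcyclesIso
  exact ⟨(e' ≪≫ e'').toLinearEquiv⟩

theorem subsingleton_homology_doubleComplex {n : ℕ} (hn : 2 ≤ n) :
    Subsingleton ((doubleComplex g).homology n) := by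
  have h : Limits.IsZero ((doubleComplex g).X n) :=
    HomologicalComplex.isZero_double_X _ _ _ (by omega) (by omega)
  have : Limits.IsZero ((doubleComplex g).homology n) :=
    (ShortComplex.exact_iff_isZero_homology _).mp
      (ShortComplex.exact_of_isZero_X₂ ((doubleComplex g).sc n) h)
  exact ModuleCat.subsingleton_of_isZero this

end Homology

/-! ### Étaleness of the Frobenius twist -/

section FrobTwist

theorem RingHom.Etale.lTensor {S C D : Type*} (W : Type*) [CommRing S] [CommRing C] [CommRing D]
    [CommRing W] [Algebra S C] [Algebra S D] [Algebra S W] {g : C →ₐ[S] D}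
    (hg : g.toRingHom.Etale) :
    (Algebra.TensorProduct.lTensor (S := W) W g).toRingHom.Etale := by
  algebraize [g.toRingHom, (Algebra.TensorProduct.lTensor (S := W) W g).toRingHom]
  have : IsScalarTower S C D := .of_algebraMap_eq' g.comp_algebraMap.symm
  let _ := Algebra.TensorProduct.rightAlgebra (R := S) (A := W) (B := C)
  let e : W ⊗[S] D ≃ₐ[W ⊗[S] C] (W ⊗[S] C) ⊗[C] D :=
    { __ := (Algebra.IsPushout.cancelBaseChangeAlg _ _ _ _ _).symm
      commutes' z := congr($(Algebra.IsPushout.cancelBaseChange_symm_comp_lTensor S C D W) z) }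
  exact .of_equiv e.symm

/-- If `A` is étale over the line with coordinate `x`, then its Frobenius twist is étale over the
line with coordinate `1 ⊗ x`. -/
theorem FrobTwist.etale_aeval_of {R : Type*} [CommRing R] (F : R →+* R) {A : Type*} [CommRing A]
    [Algebra R A] {x : A} (hx : (aeval x : R[X] →ₐ[R] A).toRingHom.Etale) :
    (aeval (FrobTwist.of F x) : R[X] →ₐ[R] FrobTwist F A).toRingHom.Etale := by
  -- The base change of a line along F is again a line, via r X ^ n ↦ r ⊗ X ^ n.
  let e : R[X] ≃+* ViaEndo F ⊗[R] R[X] :=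
    (Polynomial.mapEquiv (ViaEndo.ofBase F)).trans (polyEquivTensor' R (ViaEndo F)).toRingEquiv
  have h : (aeval (FrobTwist.of F x) : R[X] →ₐ[R] FrobTwist F A).toRingHom =
      (Algebra.TensorProduct.lTensor (S := ViaEndo F) (ViaEndo F)
        (aeval x : R[X] →ₐ[R] A)).toRingHom.comp (e : R[X] →+* ViaEndo F ⊗[R] R[X]) := by
    refine Polynomial.ringHom_ext (fun r => ?_) ?_
    · have h1 : e (C r) = (ViaEndo.ofBase F r) ⊗ₜ 1 := by simp [e]
      refine (aeval_C _ r).trans ?_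
      change ViaEndo.ofBase F r ⊗ₜ[R] (1 : A) =
        Algebra.TensorProduct.lTensor (S := ViaEndo F) (ViaEndo F) (aeval x) (e (C r))
      rw [h1, Algebra.TensorProduct.lTensor, Algebra.TensorProduct.map_tmul, map_one, AlgHom.id_apply]
    · have h1 : e X = 1 ⊗ₜ X := by simp [e]
      refine (aeval_X _).trans ?_
      change (1 : ViaEndo F) ⊗ₜ[R] x =
        Algebra.TensorProduct.lTensor (S := ViaEndo F) (ViaEndo F) (aeval x) (e X)
      rw [h1, Algebra.TensorProduct.lTensor, Algebra.TensorProduct.map_tmul, AlgHom.id_apply, aeval_X]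
  rw [h]
  exact (hx.lTensor (ViaEndo F)).comp_ringEquiv e

end FrobTwist

/-! ### The Cartier isomorphism -/

section Cartier

variable {R : Type u} [CommRing R] {A : Type v} {B : Type*} [CommRing A] [CommRing B] [Algebra R A]
  [Algebra R B] [Algebra B A] [IsScalarTower R B A]

/-- The `q`-deformed Cartier isomorphism, for the `q`-derivative given by a basis
`1, x, …, x ^ (p - 1)` of `A` over `B`. -/
theorem nonempty_homology_qDeRham_equiv {p : ℕ} (hp : p.Prime) {q : R} (hq : qNumber q p = 0)
    {x : A} {y : B} {b : Module.Basis (Fin p) B A} (hb : ∀ i, b i = x ^ (i : ℕ))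
    (hx : (aeval x : R[X] →ₐ[R] A).toRingHom.Etale)
    (hy : (aeval y : R[X] →ₐ[R] B).toRingHom.Etale) (i : ℕ) :
    Nonempty ((qDeRham x A ((qDerivative q x b).restrictScalars R)).homology i ≃ₗ[R]
      ⋀[B]^i Ω[B⁄R]) := by
  let d := (qDerivative q x b).restrictScalars R
  have hΩA := bijective_toSpanSingleton_D hx
  have hΩB := bijective_toSpanSingleton_D hy
  -- Since dx is a basis, ∇ is the q-derivative up to this isomorphism.
  let ν : A ≃ₗ[R] A ⊗[A] Ω[A⁄R] :=
    (LinearEquiv.ofBijective _ hΩA ≪≫ₗ (TensorProduct.lid A Ω[A⁄R]).symm).restrictScalars R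
  have hν : qNabla x d = ν.toLinearMap ∘ₗ d := by
    refine LinearMap.ext fun a => ?_
    change d a ⊗ₜ[A] KaehlerDifferential.D R A x =
      (1 : A) ⊗ₜ[A] (d a • KaehlerDifferential.D R A x)
    rw [← TensorProduct.smul_tmul, smul_eq_mul, mul_one]
  have hinj : Function.Injective (IsScalarTower.toAlgHom R B A).toLinearMap := by
    rw [← LinearMap.ker_eq_bot, LinearMap.ker_eq_bot']
    intro c hc
    have h0 : c • b ⟨0, hp.pos⟩ = 0 := by
      rw [hb, Algebra.smul_def]; exact mul_eq_zero_of_left hc _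
    simpa using congr(b.repr $h0 ⟨0, hp.pos⟩)
  have hlast : p - 1 < p := Nat.sub_lt hp.pos one_pos
  -- The coefficient of x ^ (p - 1), which identifies the cokernel of the q-derivative with B.
  let t : A →ₗ[R] B := (b.coord ⟨p - 1, hlast⟩).restrictScalars R
  match i with
  | 0 =>
    obtain ⟨e⟩ := nonempty_homology_zero_doubleComplex (qNabla x d)
    have hker : LinearMap.ker (qNabla x d) =
        LinearMap.range (IsScalarTower.toAlgHom R B A).toLinearMap := by
      rw [hν, LinearEquiv.ker_comp]
      ext a
      exact SetLike.ext_iff.mp (ker_qDerivative (q := q) hp hq hb) a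
    exact ⟨e ≪≫ₗ LinearEquiv.ofEq _ _ hker ≪≫ₗ (LinearEquiv.ofInjective _ hinj).symm ≪≫ₗ
      (exteriorPower.zeroEquiv B Ω[B⁄R]).symm.restrictScalars R⟩
  | 1 =>
    obtain ⟨e⟩ := nonempty_homology_one_doubleComplex (qNabla x d)
    let t' : A ⊗[A] Ω[A⁄R] →ₗ[R] B := t ∘ₗ ν.symm.toLinearMap
    have ht' : Function.Surjective t' := by
      have ht : Function.Surjective t := fun c => ⟨c • b ⟨p - 1, hlast⟩, by simp [t]⟩
      exact ht.comp ν.symm.surjective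
    have hrange : LinearMap.range (qNabla x d) = LinearMap.ker t' := by
      rw [hν, LinearMap.range_comp, LinearMap.ker_comp]
      have : LinearMap.range d = LinearMap.ker t := by
        ext a
        exact SetLike.ext_iff.mp (range_qDerivative (q := q) hp hq hb hlast) a
      rw [this]
      exact Submodule.map_equiv_eq_comap_symm ν _
    exact ⟨e ≪≫ₗ Submodule.quotEquivOfEq _ _ hrange ≪≫ₗ t'.quotKerEquivOfSurjective ht' ≪≫ₗ
      (LinearEquiv.ofBijective _ hΩB ≪≫ₗ (exteriorPower.oneEquiv B Ω[B⁄R]).symm).restrictScalars R⟩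
  | n + 2 =>
    have h1 := subsingleton_homology_doubleComplex (qNabla x d) (n := n + 2) (by omega)
    have h2 := subsingleton_exteriorPower_of_surjective hΩB.2 (n := n + 2) (by omega)
    exact ⟨⟨0, 0, fun _ => h1.elim _ _, fun _ => h2.elim _ _⟩⟩

end Cartier

theorem mainTheorem4
    {R : Type u} [CommRing R] (p : ℕ) (hp : p.Prime)
    (F : R →+* R) (hF : ∀ r : R, F r - r ^ p ∈ Ideal.span {(p : R)})
    (q : R) (hq : qNumber q p = 0) (hdiv : IsQDivisible q)
    {A : Type v} [CommRing A] [Algebra R A]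
    (f : R[X] →ₐ[R] A) (hf : f.toRingHom.Etale)
    (σ : A →ₐ[R] A) (hσ : σ (f X) = q • f X)
    (Fr : FrobTwist F A →ₐ[R] A) (hFr : Fr (FrobTwist.of F (f X)) = f X ^ p)
    (hrank : IsLocallyFreeOfRank Fr.toRingHom p)
    (hcomm : ∀ a : FrobTwist F A, σ (Fr a) = Fr a) :
    (∃! d : A →ₗ[R] A, IsSigmaDerivation σ (f X) d) ∧
    ∀ d : A →ₗ[R] A, IsSigmaDerivation σ (f X) d →
      ∀ i : ℕ, Nonempty
        ((qDeRham (f X) A d).homology i ≃ₗ[R] ⋀[FrobTwist F A]^i Ω[FrobTwist F A⁄R]) := by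
  have hx : (aeval (f X) : R[X] →ₐ[R] A).toRingHom.Etale := by
    rwa [show (aeval (f X) : R[X] →ₐ[R] A) = f from Polynomial.algHom_ext (by simp)]
  have hy := FrobTwist.etale_aeval_of F hx
  let _ : Algebra (FrobTwist F A) A := Fr.toRingHom.toAlgebra
  have : IsScalarTower R (FrobTwist F A) A := .of_algebraMap_eq' Fr.comp_algebraMap.symm
  obtain ⟨_, _, hr⟩ := hrank
  -- The relation σ ∘ F^* = F^* is what makes σ linear over A'.
  obtain ⟨b, hb⟩ := exists_basis_pow_of_etale hp hq (f X) (FrobTwist.of F (f X)) hFr hx hy hr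
    { σ with commutes' := hcomm } hσ
  have hd := isSigmaDerivation_qDerivative hp hq hFr hb σ hσ hcomm
  refine ⟨⟨_, hd, fun d' hd' => hd'.eq hx hd⟩, fun d' hd' i => ?_⟩
  obtain rfl := hd'.eq hx hd
  exact nonempty_homology_qDeRham_equiv hp hq hb hx hy i
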